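/- Let $G$ be a simple graph embedded in the plane: the vertices of $G$ are represented by distinct points of the plane, each edge is represented by a simple arc joining the points that represent its two end vertices and passing through no other point that represents a vertex, and the arcs of two distinct edges meet at most in points that represent common end vertices of these edges. Let $C$ be a cycle of $G$ (on at least three distinct vertices). Then at most two vertices of $G$ are adjacent to every vertex of $C$. -/

import Mathlib

/-- The Euclidean plane. -/
abbrev Plane : Type := EuclideanSpace ℝ (Fin 2)

/-- `A` is a simple arc in the plane with end points `p` and `q`: the image of an injective
continuous curve, defined on the unit interval, from `p` to `q`. -/
def IsArc (A : Set Plane) (p q : Plane) : Prop :=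
  ∃ γ : Path p q, Function.Injective γ ∧ Set.range γ = A

/-- An embedding of the simple graph `G` in the plane. Vertices are drawn as distinct points and
edges as simple arcs. A graph together with such an embedding is a plane graph. -/
structure PlaneEmbedding {V : Type*} (G : SimpleGraph V) where
  /-- The point that represents a vertex. -/
  point : V → Plane
  /-- The arc that represents an edge. -/
  arc : G.edgeSet → Set Plane
  /-- Distinct vertices are represented by distinct points. -/
  point_injective : Function.Injective point
  /-- The arc of an edge is a simple arc whose end points represent the end vertices. -/
  isArc : ∀ (u v : V) (h : G.Adj u v),
    IsArc (arc ⟨s(u, v), G.mem_edgeSet.mpr h⟩) (point u) (point v)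
  /-- The only points on an arc that represent vertices are its end points. -/
  mem_of_point_mem_arc : ∀ (e : G.edgeSet) (v : V), point v ∈ arc e → v ∈ (e : Sym2 V)
  /-- Arcs of distinct edges intersect only at common end points. -/
  arc_inter : ∀ e f : G.edgeSet, e ≠ f → ∀ x : Plane, x ∈ arc e → x ∈ arc f →
    ∃ v : V, v ∈ (e : Sym2 V) ∧ v ∈ (f : Sym2 V) ∧ x = point v

/-!
Three vertices joined to three vertices of the cycle form a drawing of `K₃,₃` in which disjoint
edges do not meet. Each of the three former vertices is the centre of a tripod whose feet are the
latter ones. Fix a cyclic order of the feet. The total increment of `log (γ i - a k)` along the legs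
`γ i` around the other feet `a k`, counted with the sign of the pair `(i, k)`, is an odd multiple of
`π * I`. If the legs `γ i` and `δ k` of two tripods are disjoint for `i ≠ k`, the function
`γ i s - δ k t` has a logarithm on the unit square, and the increments of that logarithm along the
four sides show that the invariants of the two tripods are opposite. Three nonzero numbers cannot be
pairwise opposite.
-/

open scoped unitInterval

section Logarithm

variable {X : Type*} [TopologicalSpace X]

theorem exists_continuous_exp_eq [SimplyConnectedSpace X] [LocallyPathConnectedSpace X]
    {f : X → ℂ} (hf : Continuous f) (hf₀ : ∀ x, f x ≠ 0) :
    ∃ L : X → ℂ, Continuous L ∧ ∀ x, Complex.exp (L x) = f x := by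
  obtain ⟨x₀⟩ := (inferInstance : Nonempty X)
  obtain ⟨L, ⟨-, hL⟩, -⟩ := Complex.isCoveringMapOn_exp.existsUnique_continuousMap_lifts
    ⟨f, hf⟩ (Complex.exp_log (hf₀ x₀)) hf₀
  exact ⟨L, L.continuous, congrFun hL⟩

theorem sub_eq_sub_of_exp_eq_exp [PreconnectedSpace X] {L K : X → ℂ} (hL : Continuous L)
    (hK : Continuous K) (h : ∀ x, Complex.exp (L x) = Complex.exp (K x)) (x y : X) :
    L x - L y = K x - K y := by
  have exp_sub (z : X) : Complex.exp (L z - K z) = 1 := by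
    rw [Complex.exp_sub, h, div_self (Complex.exp_ne_zero _)]
  exact sub_eq_sub_iff_sub_eq_sub.mp <| Complex.isCoveringMap_exp.const_of_comp
    (hL.sub hK) (fun z w ↦ Subtype.ext <| (exp_sub z).trans (exp_sub w).symm) x y

end Logarithm

instance : ContractibleSpace I :=
  (convex_Icc 0 1).contractibleSpace ⟨0, unitInterval.zero_mem⟩

instance : LocallyPathConnectedSpace I :=
  (convex_Icc 0 1).locallyPathConnectedSpace

section LogIncrement

variable {f L : I → ℂ}

/-- The increment over the unit interval of a continuous logarithm of `f`. It does not depend on the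
choice of the logarithm, and is `0` by convention if there is none. -/
noncomputable def logIncrement (f : I → ℂ) : ℂ :=
  open Classical in
  if h : ∃ L : I → ℂ, Continuous L ∧ ∀ t, Complex.exp (L t) = f t then h.choose 1 - h.choose 0
  else 0

theorem logIncrement_eq_sub (hL : Continuous L) (h : ∀ t, Complex.exp (L t) = f t) :
    logIncrement f = L 1 - L 0 := by
  have hex : ∃ L : I → ℂ, Continuous L ∧ ∀ t, Complex.exp (L t) = f t := ⟨L, hL, h⟩
  rw [logIncrement, dif_pos hex]
  exact sub_eq_sub_of_exp_eq_exp hex.choose_spec.1 hL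
    (fun t ↦ (hex.choose_spec.2 t).trans (h t).symm) 1 0

theorem exp_logIncrement (hf : Continuous f) (hf₀ : ∀ t, f t ≠ 0) :
    Complex.exp (logIncrement f) = f 1 / f 0 := by
  obtain ⟨L, hL, hLf⟩ := exists_continuous_exp_eq hf hf₀
  rw [logIncrement_eq_sub hL hLf, Complex.exp_sub, hLf, hLf]

theorem logIncrement_neg (hf : Continuous f) (hf₀ : ∀ t, f t ≠ 0) :
    logIncrement (-f) = logIncrement f := by
  obtain ⟨L, hL, hLf⟩ := exists_continuous_exp_eq hf hf₀
  have exp_add_pi (t : I) : Complex.exp (L t + Real.pi * Complex.I) = (-f) t := by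
    rw [Complex.exp_add, Complex.exp_pi_mul_I, hLf, mul_neg_one, Pi.neg_apply]
  rw [logIncrement_eq_sub hL hLf, logIncrement_eq_sub (by fun_prop) exp_add_pi,
    add_sub_add_right_eq_sub]

theorem logIncrement_boundary_square {F : I × I → ℂ} (hF : Continuous F) (hF₀ : ∀ x, F x ≠ 0) :
    logIncrement (fun s ↦ F (s, 0)) + logIncrement (fun t ↦ F (1, t)) =
      logIncrement (fun t ↦ F (0, t)) + logIncrement (fun s ↦ F (s, 1)) := by
  obtain ⟨L, hL, hLF⟩ := exists_continuous_exp_eq hF hF₀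
  rw [logIncrement_eq_sub (L := fun s ↦ L (s, 0)) (by fun_prop) fun _ ↦ hLF _,
    logIncrement_eq_sub (L := fun t ↦ L (1, t)) (by fun_prop) fun _ ↦ hLF _,
    logIncrement_eq_sub (L := fun t ↦ L (0, t)) (by fun_prop) fun _ ↦ hLF _,
    logIncrement_eq_sub (L := fun s ↦ L (s, 1)) (by fun_prop) fun _ ↦ hLF _]
  ring

theorem logIncrement_sub_eq_of_disjoint {a b c d : ℂ} {γ : Path a c} {δ : Path b d}
    (h : Disjoint (Set.range γ) (Set.range δ)) :
    logIncrement (γ · - b) - logIncrement (γ · - d) =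
      logIncrement (δ · - a) - logIncrement (δ · - c) := by
  have ne (s t : I) : γ s ≠ δ t := fun e ↦ Set.disjoint_left.mp h ⟨s, rfl⟩ ⟨t, e.symm⟩
  have around {x : ℂ} (hx : ∀ t, x ≠ δ t) : logIncrement (x - δ ·) = logIncrement (δ · - x) := by
    rw [← logIncrement_neg (by fun_prop) fun t ↦ sub_ne_zero.mpr (hx t)]
    simp only [Pi.neg_def, neg_sub]
  have square := logIncrement_boundary_square (F := fun x ↦ γ x.1 - δ x.2) (by fun_prop)
    fun x ↦ sub_ne_zero.mpr (ne x.1 x.2)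
  simp only [Path.source, Path.target, around fun t ↦ γ.source ▸ ne 0 t,
    around fun t ↦ γ.target ▸ ne 1 t] at square
  linear_combination square

end LogIncrement

section Turning

variable {ι : Type*} [Fintype ι] {τ : Equiv.Perm ι} {a : ι → ℂ} {c d : ℂ}

/-- The turning of the star with centre `c`, feet `a i` and legs `γ i`, with respect to a cyclic
order of the legs, encoded by the permutation `τ` that sends each leg to the next: the increment of
`log (γ i - a k)` counts positively if `k = τ i` and negatively if `i = τ k`. For a tripod it is an
odd multiple of `π * I` that changes sign when the tripod is reflected. -/
noncomputable def starTurning (τ : Equiv.Perm ι) (γ : ∀ i, Path (a i) c) : ℂ :=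
  ∑ i, (logIncrement (γ i · - a (τ i)) - logIncrement (γ (τ i) · - a i))

theorem exp_starTurning (hτ : ∀ i, τ i ≠ i) {γ : ∀ i, Path (a i) c}
    (h : Pairwise fun i k ↦ a k ∉ Set.range (γ i)) :
    Complex.exp (starTurning τ γ) = (-1) ^ Fintype.card ι := by
  have ne_foot {i k : ι} (hik : i ≠ k) (t : I) : γ i t - a k ≠ 0 :=
    sub_ne_zero.mpr fun e ↦ h hik ⟨t, e⟩
  have exp_leg {i k : ι} (hik : i ≠ k) :
      Complex.exp (logIncrement (γ i · - a k)) = (c - a k) / (a i - a k) := by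
    simpa only [Path.source, Path.target] using exp_logIncrement (by fun_prop) (ne_foot hik)
  have center_ne (i : ι) : c - a i ≠ 0 := by simpa using ne_foot (hτ i) 1
  have exp_summand (i : ι) :
      Complex.exp (logIncrement (γ i · - a (τ i)) - logIncrement (γ (τ i) · - a i)) =
        -((c - a (τ i)) / (c - a i)) := by
    have feet_ne : a i - a (τ i) ≠ 0 := by simpa using ne_foot (hτ i).symm 0
    rw [Complex.exp_sub, exp_leg (hτ i).symm, exp_leg (hτ i), ← neg_sub (a i) (a (τ i))]
    field_simp [center_ne i]
  calc Complex.exp (starTurning τ γ)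
    _ = ∏ i, -((c - a (τ i)) / (c - a i)) := by
      simp only [starTurning, Complex.exp_sum, exp_summand]
    _ = (-1) ^ Fintype.card ι * ((∏ i, (c - a (τ i))) / ∏ i, (c - a i)) := by
      rw [Finset.prod_neg, Finset.prod_div_distrib, Finset.card_univ]
    _ = (-1) ^ Fintype.card ι := by
      rw [Equiv.prod_comp τ (c - a ·), div_self (Finset.prod_ne_zero_iff.mpr fun i _ ↦ center_ne i),
        mul_one]

theorem starTurning_eq_neg (hτ : ∀ i, τ i ≠ i) {γ : ∀ i, Path (a i) c} {δ : ∀ i, Path (a i) d}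
    (h : Pairwise fun i k ↦ Disjoint (Set.range (γ i)) (Set.range (δ k))) :
    starTurning τ γ = -starTurning τ δ := by
  let f (i : ι) : ℂ := logIncrement (γ i · - d) + logIncrement (δ i · - c)
  have summand (i : ι) :
      logIncrement (γ i · - a (τ i)) - logIncrement (γ (τ i) · - a i) =
        -(logIncrement (δ i · - a (τ i)) - logIncrement (δ (τ i) · - a i)) + (f i - f (τ i)) := by
    linear_combination logIncrement_sub_eq_of_disjoint (h (hτ i).symm) -
      logIncrement_sub_eq_of_disjoint (h (hτ i))
  simp only [starTurning, summand, Finset.sum_add_distrib, Finset.sum_neg_distrib,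
    Finset.sum_sub_distrib f, Equiv.sum_comp τ f, sub_self, add_zero]

end Turning

theorem exists_not_disjoint_of_completeBipartite_three_three {a b : Fin 3 → ℂ}
    (γ : ∀ i j, Path (a i) (b j)) :
    ∃ i k j l, i ≠ k ∧ j ≠ l ∧ ¬Disjoint (Set.range (γ i j)) (Set.range (γ k l)) := by
  by_contra! disjoint
  have rotate_ne : ∀ i, finRotate 3 i ≠ i := by decide
  let turn (j : Fin 3) : ℂ := starTurning (finRotate 3) (γ · j)
  have turn_eq_neg {j l : Fin 3} (hjl : j ≠ l) : turn j = -turn l :=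
    starTurning_eq_neg rotate_ne fun i k hik ↦ disjoint i k j l hik hjl
  have turn_zero : turn 0 = 0 := by
    linear_combination (turn_eq_neg (j := 0) (l := 1) (by decide) +
      turn_eq_neg (j := 0) (l := 2) (by decide) - turn_eq_neg (j := 1) (l := 2) (by decide)) / 2
  have foot_notMem : Pairwise fun i k ↦ a k ∉ Set.range (γ i 0) := fun i k hik hk ↦
    Set.disjoint_left.mp (disjoint i k 0 1 hik (by decide)) hk ⟨0, (γ k 1).source⟩
  have exp_turn_zero : Complex.exp (turn 0) = (-1) ^ 3 := exp_starTurning rotate_ne foot_notMem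
  norm_num [turn_zero] at exp_turn_zero

theorem nonempty_fin_embedding_of_le_encard {α : Type*} {s : Set α} {n : ℕ} (h : n ≤ s.encard) :
    Nonempty (Fin n ↪ s) := by
  obtain ⟨f, -⟩ := Fin.Embedding.exists_embedding_disjoint_range_of_add_le_ENat_card
    (s := (∅ : Set s)) (n := n) (by simpa using h)
  exact ⟨f⟩

namespace PlaneEmbedding

variable {V : Type*} {G : SimpleGraph V} (P : PlaneEmbedding G) {u v u' v' : V}

/-- A parametrization of the arc of the edge `uv`, traversed from `u` to `v`. -/
noncomputable def path (h : G.Adj u v) : Path (P.point u) (P.point v) :=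
  (P.isArc u v h).choose

theorem range_path (h : G.Adj u v) : Set.range (P.path h) = P.arc ⟨s(u, v), h⟩ :=
  (P.isArc u v h).choose_spec.2

theorem disjoint_range_path (h : G.Adj u v) (h' : G.Adj u' v')
    (hends : Disjoint {u, v} ({u', v'} : Set V)) :
    Disjoint (Set.range (P.path h)) (Set.range (P.path h')) := by
  have no_common_end (w : V) (hw : w ∈ s(u, v)) (hw' : w ∈ s(u', v')) : False :=
    Set.disjoint_left.mp hends (Sym2.mem_iff.mp hw) (Sym2.mem_iff.mp hw')
  have edges_ne : (⟨s(u, v), h⟩ : G.edgeSet) ≠ ⟨s(u', v'), h'⟩ := fun e ↦ by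
    have hu : u ∈ s(u, v) := Sym2.mem_mk_left u v
    exact no_common_end u hu (Subtype.mk.inj e ▸ hu)
  rw [P.range_path, P.range_path, Set.disjoint_left]
  intro x hx hx'
  obtain ⟨w, hw, hw', -⟩ := P.arc_inter _ _ edges_ne x hx hx'
  exact no_common_end w hw hw'

end PlaneEmbedding

theorem three_le_encard_support_of_isCycle {V : Type*} {G : SimpleGraph V} {a : V}
    {C : G.Walk a a} (hC : C.IsCycle) : 3 ≤ {w | w ∈ C.support}.encard := by
  classical
  calc (3 : ℕ∞)
    _ ≤ C.support.tail.length := by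
      simpa using! hC.three_le_length
    _ = (C.support.tail.toFinset : Set V).encard := by
      rw [Set.encard_coe_eq_coe_finsetCard, List.toFinset_card_of_nodup hC.support_nodup]
    _ ≤ {w | w ∈ C.support}.encard := Set.encard_le_encard fun w hw ↦
      List.mem_of_mem_tail (List.mem_toFinset.mp hw)

theorem corollary1_general {V : Type*} {G : SimpleGraph V} {p : V → Plane}
    (γ : ∀ {u v}, G.Adj u v → Path (p u) (p v))
    (hγ : ∀ {u v u' v'} (h : G.Adj u v) (h' : G.Adj u' v'),
      Disjoint {u, v} ({u', v'} : Set V) → Disjoint (Set.range (γ h)) (Set.range (γ h')))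
    {S : Set V} (hS : 3 ≤ S.encard) :
    {v : V | ∀ w ∈ S, G.Adj v w}.encard ≤ 2 := by
  by_contra! hcard
  obtain ⟨w⟩ := nonempty_fin_embedding_of_le_encard (n := 3) hS
  obtain ⟨v⟩ := nonempty_fin_embedding_of_le_encard (n := 3) (Order.add_one_le_of_lt hcard)
  have adj (i j : Fin 3) : G.Adj (w i) (v j) := ((v j).2 (w i) (w i).2).symm
  let φ := Complex.orthonormalBasisOneI.repr.symm
  obtain ⟨i, k, j, l, hik, hjl, hmeet⟩ := exists_not_disjoint_of_completeBipartite_three_three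
    fun i j ↦ (γ (adj i j)).map φ.continuous
  have ends_disjoint : Disjoint {(w i : V), (v j : V)} ({(w k : V), (v l : V)} : Set V) := by
    simp [Subtype.val_inj, hik.symm, hjl.symm, (adj _ _).ne, (adj _ _).ne']
  refine hmeet ?_
  simp only [Path.map_coe, Set.range_comp]
  exact (Set.disjoint_image_iff φ.injective).mpr (hγ _ _ ends_disjoint)

/-- In a plane graph, at most two vertices are adjacent to every vertex of a given cycle. -/
theorem corollary1 {V : Type*} (G : SimpleGraph V) (P : PlaneEmbedding G)
    {a : V} (C : G.Walk a a) (hC : C.IsCycle) :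
    {v : V | ∀ w ∈ C.support, G.Adj v w}.encard ≤ 2 :=
  corollary1_general P.path P.disjoint_range_path (three_le_encard_support_of_isCycle hC)
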